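/- **Setting.** Let $\mathcal N$ be a finite set of $n$ chains, $f_{max}=\lfloor (n-1)/3\rfloor$ and $\Phi=2f_{max}+1$, and assume $\Phi>n/2$. Each chain $q$ is a single agreed, ever growing chain of valid blocks $b_{q,0},b_{q,1},b_{q,2},\dots$. Each block acks finitely many blocks, $b_{q,i+1}$ acks $b_{q,i}$, and the resulting graph is acyclic. Write $x\succeq y$ if $x=y$ or $x$ acks $y$ directly or indirectly (through a chain of acks). The set $\mathcal F\subseteq\mathcal N$ of chains containing blocks from Byzantine nodes has at most $f_{max}$ elements. For each chain $q\notin\mathcal F$: every block of $q$ acks, for every chain $r\ne q$ of which its proposer has received a block when proposing, the latest such block (a proposer has received finitely many blocks at that time); and each block of the blocklattice has been received by the proposers of all but finitely many blocks of $q$. **Algorithm.** A node runs the DEXON total ordering algorithm on a sequence of input blocks. At any time let $\mathcal P$ be the set of blocks received and not yet output, and $\mathcal C$ the set of candidates, i.e. of $b\in\mathcal P$ such that all blocks acked by $b$ have been output. For $b\in\mathcal C$ let $ANS(b)=\{j:\exists k,\ b_{j,k}\in\mathcal P,\ b_{j,k}\succeq b\}$ and $ANS=\bigcup_{b\in\mathcal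 C}ANS(b)$. Let $AHV(b)[q]=\bot$ if $q\notin ANS$; otherwise, with $k=\min\{i:b_{q,i}\in\mathcal P\}$, let $AHV(b)[q]=k$ if $b_{q,k}\succeq b$ and $AHV(b)[q]=\infty$ if not. Let $\#AHV(b)$ be the number of integer entries of $AHV(b)$, and $c(b_1,b_2)=|\{j: AHV(b_1)[j]<AHV(b_2)[j]\}|$. Put $Grade(b_1,b_2)=1$ if $c(b_1,b_2)>\Phi$; $Grade(b_1,b_2)=0$ if $c(b_1,b_2)<\Phi-(n-|ANS|)$ (strict bound), respectively if $c(b_1,b_2)\le\Phi-(n-|ANS|)$ (exact bound); and $Grade(b_1,b_2)=\bot$ otherwise. The preceding set is $\mathcal A=\{b\in\mathcal C:\ Grade(b',b)=0\ \text{for all } b'\in\mathcal C\}$. Internal stability means that for each $b\in\mathcal C\setminus\mathcal A$ there is $b'\in\mathcal A$ with $Grade(b',b)=1$. The criterion for output is one of the following: * (stability form) internal stability holds and, moreover, (a) $|ANS|=n$, or (b) $\#AHV(b)>\Phi$ for some $b\in\mathcal A$ and $|ANS(b)|\ge n-\Phi$ for all $b\in\mathcal A$; * (simplified form) $|ANS|=n$,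 or internal stability holds and $\mathcal C\setminus\mathcal A\neq\emptyset$. Whenever the criterion holds, the node outputs $\mathcal A$, its blocks being ordered by their hash values, and recomputes all these quantities; whenever it does not hold, the node receives its next input block. **Theorem (validity of liveness for total ordering).** Suppose that every block of the blocklattice occurs in the input sequence of the node, in whatever order. Let the algorithm use the simplified form of the criterion with either bound in $Grade$, or the stability form with the exact bound. Then every valid block $b$ that is input to the algorithm is eventually output by it. -/

import Mathlib

/-! Blocklattices and the DEXON total ordering algorithm, run by one node. -/

namespace Dexon

/-- `(q, i)` is the block `b_{q,i}`, of height `i` (starting at `0`) in the chain `q`.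
Every chain is a single agreed chain that keeps growing, so all pairs are (valid) blocks. -/
abbrev Block (N : Type*) := N × ℕ

/-- A blocklattice: every block has a finite ack field, a block acks the block that it follows
in its own chain, and the resulting graph is acyclic. -/
structure Blocklattice (N : Type*) where
  /-- the blocks that a block (directly) acks -/
  acks : Block N → Finset (Block N)
  acks_parent : ∀ (q : N) (i : ℕ), (q, i) ∈ acks (q, i + 1)
  acyclic : ∀ b : Block N, ¬ Relation.TransGen (fun x y => y ∈ acks x) b b

/-- `L.AcksStar x y`: the block `x` is `y`, or acks `y` directly or indirectly. (As usual for
the acking functions below, a block counts as supporting itself.) -/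
def Blocklattice.AcksStar {N : Type*} (L : Blocklattice N) : Block N → Block N → Prop :=
  Relation.ReflTransGen (fun x y => y ∈ L.acks x)

/-- `f_max = ⌊(|N| - 1) / 3⌋`, the largest admissible number of Byzantine chains. -/
def fMax (N : Type*) [Fintype N] : ℕ := (Fintype.card N - 1) / 3

/-- The output threshold `Φ = 2 f_max + 1`. -/
def threshold (N : Type*) [Fintype N] : ℕ := 2 * fMax N + 1

/-- The acking rule for the chain `q`. Here `view x` is the set of the blocks that the proposer
of the block `x` has received when it proposes `x`: each block of the chain acks the latest
block, among those received by its proposer, of every other chain. -/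
def FollowsAckRule {N : Type*} (L : Blocklattice N) (view : Block N → Finset (Block N))
    (q : N) : Prop :=
  ∀ (i : ℕ) (r : N) (k : ℕ), r ≠ q → (r, k) ∈ view (q, i) →
    (∀ k' : ℕ, (r, k') ∈ view (q, i) → k' ≤ k) → (r, k) ∈ L.acks (q, i)

/-- The local state of the node that runs the algorithm. -/
structure State (N : Type*) where
  /-- the number of inputs processed so far -/
  clock : ℕ
  /-- the blocks received so far -/
  received : Finset (Block N)
  /-- the blocks output so far, in this order (the compaction chain) -/
  output : List (Block N)

/-- The two forms of the criterion for output. -/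
inductive CriterionForm
  /-- internal stability together with external stability -/
  | stability
  /-- the simplified form: normal delivery or early delivery -/
  | simplified

/-- How the borderline case in `Grade = 0` is treated: with `c` the number of the chains in which
`b₁` is currently ahead of `b₂`, and `u` the number of chains not yet in view. -/
inductive GradeBound
  /-- `Grade = 0` iff `c < Φ - u` -/
  | strict
  /-- `Grade = 0` iff `c ≤ Φ - u`, that is, iff `b₁` can never precede `b₂`, whatever arrives -/
  | exact

section Algorithm

open Classical

variable {N : Type*} [Fintype N] (L : Blocklattice N)

/-- `𝒫`: the blocks received and not yet output. -/
noncomputable def pending (s : State N) : Finset (Block N) :=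
  s.received.filter (fun b => b ∉ s.output)

/-- `𝒞`: the pending blocks that only ack blocks that have been output. -/
noncomputable def candidates (s : State N) : Finset (Block N) :=
  (pending s).filter (fun b => ∀ a ∈ L.acks b, a ∈ s.output)

/-- The acking node set `ANS(b)`. The issuer of a pending `b` is in it, through `b` itself. -/
noncomputable def ANS (s : State N) (b : Block N) : Finset N :=
  Finset.univ.filter (fun j => ∃ k : ℕ, (j, k) ∈ pending s ∧ L.AcksStar (j, k) b)

/-- The global acking node set, the union of `ANS(b)` over the candidates `b`. -/
noncomputable def globalANS (s : State N) : Finset N :=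
  (candidates L s).biUnion (ANS L s)

/-- The least height of a pending block of the chain `q`
(only used for chains that have a pending block). -/
noncomputable def firstHeight (s : State N) (q : N) : ℕ :=
  sInf {i : ℕ | (q, i) ∈ pending s}

/-- The acking block-height vector `AHV(b)`; `⊤` stands for the entry `∞`. -/
noncomputable def AHV (s : State N) (b : Block N) (q : N) : WithBot ℕ∞ :=
  if q ∉ globalANS L s then ⊥
  else if L.AcksStar (q, firstHeight s q) b then ((firstHeight s q : ℕ∞) : WithBot ℕ∞)
  else ⊤

/-- `#AHV(b)`: the number of the integer entries of `AHV(b)`. -/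
noncomputable def numAHV (s : State N) (b : Block N) : ℕ :=
  (Finset.univ.filter (fun j => AHV L s b j ≠ ⊥ ∧ AHV L s b j ≠ ⊤)).card

/-- The number of the chains `j` with `AHV(b₁)[j] < AHV(b₂)[j]`. -/
noncomputable def aheadCount (s : State N) (b₁ b₂ : Block N) : ℕ :=
  (Finset.univ.filter (fun j => AHV L s b₁ j < AHV L s b₂ j)).card

/-- `Precede(b₁, b₂)`. -/
noncomputable def precede (s : State N) (b₁ b₂ : Block N) : ℤ :=
  if threshold N < aheadCount L s b₁ b₂ then 1
  else if threshold N < aheadCount L s b₂ b₁ then -1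
  else 0

/-- `Grade(b₁, b₂)`, with `none` for `⊥`. When blocks arrive after the blocks that they ack, the
entries of `AHV` for chains in view are settled until the next output, so before it
`b₁` precedes `b₂` in all future views iff it does so now; and at most the chains that are
not in view, `|N| - |ANS|` in number, can still be added to `aheadCount`. -/
noncomputable def grade (g : GradeBound) (s : State N) (b₁ b₂ : Block N) : Option ℕ :=
  let reach : ℕ := aheadCount L s b₁ b₂ + (Fintype.card N - (globalANS L s).card)
  if precede L s b₁ b₂ = 1 then some 1
  else match g with
    | .strict => if reach < threshold N then some 0 else none
    | .exact => if reach ≤ threshold N then some 0 else none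

/-- `𝒜`: the preceding set. -/
noncomputable def preceding (g : GradeBound) (s : State N) : Finset (Block N) :=
  (candidates L s).filter (fun b => ∀ b' ∈ candidates L s, grade L g s b' b = some 0)

/-- Internal stability. -/
def InternalStability (g : GradeBound) (s : State N) : Prop :=
  ∀ b ∈ candidates L s \ preceding L g s, ∃ b' ∈ preceding L g s, grade L g s b' b = some 1

/-- External stability: (a) or (b). -/
def ExternalStability (g : GradeBound) (s : State N) : Prop :=
  (globalANS L s).card = Fintype.card N ∨
    ((∃ b ∈ preceding L g s, threshold N < numAHV L s b) ∧
      ∀ b ∈ preceding L g s, Fintype.card N - threshold N ≤ (ANS L s b).card)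

/-- The criterion under which the preceding set is output. -/
def Criterion (c : CriterionForm) (g : GradeBound) (s : State N) : Prop :=
  match c with
  | .stability => InternalStability L g s ∧ ExternalStability L g s
  | .simplified =>
      (globalANS L s).card = Fintype.card N ∨
        (InternalStability L g s ∧ (candidates L s \ preceding L g s).Nonempty)

/-- Output of the preceding set, in the order of the hash values of its blocks. -/
noncomputable def deliver {H : Type*} [LinearOrder H] (hash : Block N → H) (g : GradeBound)
    (s : State N) : State N :=
  { s with output :=
      s.output ++ (preceding L g s).toList.mergeSort (fun a b => decide (hash a ≤ hash b)) }

/-- Reception of the block `b`. -/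
noncomputable def receive (s : State N) (b : Block N) : State N :=
  { s with clock := s.clock + 1, received := insert b s.received }

/-- One event: an output if the criterion holds, and otherwise the reception of the next input. -/
noncomputable def step {H : Type*} [LinearOrder H] (hash : Block N → H) (c : CriterionForm)
    (g : GradeBound) (input : ℕ → Block N) (s : State N) : State N :=
  if Criterion L c g s then deliver L hash g s else receive s (input s.clock)

/-- The state of the node after `t` events. -/
noncomputable def run {H : Type*} [LinearOrder H] (hash : Block N → H) (c : CriterionForm)
    (g : GradeBound) (input : ℕ → Block N) (t : ℕ) : State N :=
  (step L hash c g input)^[t] ⟨0, ∅, []⟩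

end Algorithm

end Dexon

/-!
Liveness of the total ordering algorithm.

Inside a fixed state all finite entries in a column of the acking height vectors agree, so
`aheadCount b₁ b₂` is the size of a difference of two sets of chains, the `supporters` of `b₁` and
of `b₂`. As `Φ > n / 2`, counting supporters shows that the preceding set is never empty when the
criterion holds (`Criterion.preceding_nonempty`) and that the criterion holds once all chains are in
view (`criterion_of_card_eq`). Hence the node never stops receiving (`eventually_mem_received`) and,
because acking is well-founded, never stops delivering (`frequently_criterion`): when nothing is
delivered any more, every chain comes into view through a candidate below its first pending block.

Suppose now that some block `b` is stuck, that is, never output. Late blocks of chains outside `F`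
support `b` and the set of output blocks is closed under acking, so the chains that are drained (all
of whose blocks are output) lie in `F`; there are at most `f_max` of them. The first stuck blocks of
the other chains have finite pasts. Late in the run the node has settled these pasts: it has received
them, and has output whatever it will ever output of them. From then on

* all chains that are not drained are in view, and their first pending blocks are stuck;
* a pending block that will be output is supported by drained chains only, as a support by a stuck
  first block would put it into a settled past;
* a stuck block is supported by no drained chain.

Take a late delivery, of a preceding set that contains some `x`, and any candidate `m`.
A candidate that will be output has at most `f_max` supporters, and at most `f_max` chains are out of
view; since `2 f_max < Φ` its grade against `m` is `0`. The supporters of a stuck candidate `b'` are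
disjoint from those of `x`, so `b'` is ahead of `x` in at least as many chains as it is ahead of `m`;
as its grade against `x` is `0`, so is its grade against `m`. Thus `m` is in the preceding set
(`mem_preceding_of_isSettled`) and is output. But some candidate is stuck
(`exists_stuck_candidate`), a contradiction.
-/

namespace Dexon

open Filter

open Classical

variable {N : Type*}

/-! ### The acking relation -/

theorem Blocklattice.acksStar_of_le (L : Blocklattice N) (q : N) {i j : ℕ} (h : i ≤ j) :
    L.AcksStar (q, j) (q, i) := by
  induction j, h using Nat.le_induction with
  | base => exact .refl
  | succ j _ ih => exact .head (L.acks_parent q j) ih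

/-- An infinite descending path would visit some chain twice, the second time at no smaller
height (by Dickson's lemma); as blocks ack their predecessors, this closes a cycle. -/
theorem Blocklattice.wellFounded [Finite N] (L : Blocklattice N) :
    WellFounded (fun y x : Block N => y ∈ L.acks x) := by
  rw [wellFounded_iff_isEmpty_descending_chain]
  refine ⟨fun ⟨f, hf⟩ => ?_⟩
  have path : ∀ i d, Relation.TransGen (fun x y => y ∈ L.acks x) (f i) (f (i + d + 1)) := by
    intro i d
    induction d with
    | zero => exact .single (hf i)
    | succ d ih => exact ih.tail (hf _)
  obtain ⟨i, j, hij, hchain, hle⟩ :=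
    (Finite.wellQuasiOrdered (α := N) (· = ·)).prod (wellQuasiOrdered_le (α := ℕ)) f
  obtain ⟨d, rfl⟩ := Nat.exists_eq_add_of_lt hij
  have hback : L.AcksStar (f (i + d + 1)) (f i) := by
    have h := L.acksStar_of_le (f i).1 hle
    rwa [show ((f i).1, (f (i + d + 1)).2) = f (i + d + 1) from Prod.ext hchain rfl] at h
  exact L.acyclic _ ((path i d).trans_left hback)

theorem Blocklattice.finite_setOf_acksStar [Finite N] (L : Blocklattice N) (b : Block N) :
    {a | L.AcksStar b a}.Finite := by
  induction b using L.wellFounded.induction with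
  | _ b ih =>
    refine ((Set.finite_singleton b).union ((L.acks b).finite_toSet.biUnion ih)).subset ?_
    intro a ha
    rcases Relation.ReflTransGen.cases_head ha with rfl | ⟨y, hy, hya⟩
    · exact .inl rfl
    · exact .inr (Set.mem_biUnion hy hya)

/-- Below every block outside `U` there is a minimal block outside `U`. -/
theorem Blocklattice.exists_minimal [Finite N] (L : Blocklattice N) (U : Set (Block N))
    (b : Block N) (hb : b ∉ U) :
    ∃ m, L.AcksStar b m ∧ m ∉ U ∧ ∀ a ∈ L.acks m, a ∈ U := by
  induction b using L.wellFounded.induction with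
  | _ b ih =>
    by_cases h : ∀ a ∈ L.acks b, a ∈ U
    · exact ⟨b, .refl, hb, h⟩
    · push Not at h
      obtain ⟨a, hab, haU⟩ := h
      obtain ⟨m, hm, h'⟩ := ih a hab haU
      exact ⟨m, .head hab hm, h'⟩

/-- A set that is closed under `acks` is closed under `AcksStar`. -/
theorem Blocklattice.AcksStar.mem {L : Blocklattice N} {U : Set (Block N)}
    (hU : ∀ x ∈ U, ∀ a ∈ L.acks x, a ∈ U) {x y : Block N} (h : L.AcksStar x y) (hx : x ∈ U) :
    y ∈ U := by
  induction h with
  | refl => exact hx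
  | tail _ hyz ih => exact hU _ ih _ hyz

/-- By the acking rule, a chain all of whose late proposers have received `b` supports `b`. -/
theorem FollowsAckRule.exists_acksStar {L : Blocklattice N} {view : Block N → Finset (Block N)}
    {q : N} (hq : FollowsAckRule L view q) {b : Block N}
    (hb : ∀ᶠ i in atTop, b ∈ view (q, i)) : ∃ i, L.AcksStar (q, i) b := by
  obtain ⟨r, k⟩ := b
  by_cases hr : r = q
  · exact ⟨k, hr ▸ .refl⟩
  obtain ⟨i, hi⟩ := hb.exists
  have hne : ((view (q, i)).filter (fun x => x.1 = r)).Nonempty := ⟨(r, k), by simp [hi]⟩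
  obtain ⟨⟨r', k'⟩, hmem, hmax⟩ := Finset.exists_max_image _ Prod.snd hne
  obtain ⟨hview, rfl : r' = r⟩ := Finset.mem_filter.mp hmem
  refine ⟨i, .head (hq i r' k' hr hview fun k₂ h₂ => hmax (r', k₂) (by simp [h₂])) ?_⟩
  exact L.acksStar_of_le r' (hmax (r', k) (by simp [hi]))

/-! ### Grades in a fixed state -/

theorem mem_pending {s : State N} {b : Block N} :
    b ∈ pending s ↔ b ∈ s.received ∧ b ∉ s.output := by
  simp [pending]

variable [Fintype N] (L : Blocklattice N)

/-- The chains in view whose first pending block supports `b`, that is, the chains with an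
integer entry in `AHV(b)`. -/
noncomputable def supporters (s : State N) (b : Block N) : Finset N :=
  Finset.univ.filter (fun j => j ∈ globalANS L s ∧ L.AcksStar (j, firstHeight s j) b)

theorem mem_supporters {s : State N} {b : Block N} {j : N} :
    j ∈ supporters L s b ↔ j ∈ globalANS L s ∧ L.AcksStar (j, firstHeight s j) b := by
  simp [supporters]

theorem AHV_lt_AHV_iff (s : State N) (b₁ b₂ : Block N) (j : N) :
    AHV L s b₁ j < AHV L s b₂ j ↔ j ∈ supporters L s b₁ ∧ j ∉ supporters L s b₂ := by
  have htop : (((firstHeight s j : ℕ) : ℕ∞) : WithBot ℕ∞) < ⊤ :=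
    WithBot.coe_lt_coe.mpr (ENat.natCast_lt_top _)
  simp only [mem_supporters, AHV]
  by_cases hj : j ∈ globalANS L s
  · by_cases h₁ : L.AcksStar (j, firstHeight s j) b₁
    · by_cases h₂ : L.AcksStar (j, firstHeight s j) b₂
      · simp [hj, h₁, h₂]
      · simpa [hj, h₁, h₂] using htop
    · simp [hj, h₁]
  · simp [hj]

/-- In a fixed state all finite entries of a column of `AHV` coincide, so that comparing two
vectors amounts to comparing two sets of supporters. -/
theorem aheadCount_eq (s : State N) (b₁ b₂ : Block N) :
    aheadCount L s b₁ b₂ = (supporters L s b₁ \ supporters L s b₂).card := by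
  unfold aheadCount
  congr 1
  ext j
  simp [AHV_lt_AHV_iff]

theorem precede_eq_one_iff (s : State N) (b₁ b₂ : Block N) :
    precede L s b₁ b₂ = 1 ↔ threshold N < aheadCount L s b₁ b₂ := by
  unfold precede
  split_ifs <;> simp_all

theorem grade_eq_one_iff (g : GradeBound) (s : State N) (b₁ b₂ : Block N) :
    grade L g s b₁ b₂ = some 1 ↔ threshold N < aheadCount L s b₁ b₂ := by
  cases g <;> simp only [grade, precede_eq_one_iff] <;> split_ifs <;> simp_all

theorem grade_strict_eq_zero_iff (s : State N) (b₁ b₂ : Block N) :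
    grade L .strict s b₁ b₂ = some 0 ↔
      aheadCount L s b₁ b₂ + (Fintype.card N - (globalANS L s).card) < threshold N := by
  simp only [grade, precede_eq_one_iff]
  split_ifs <;> simp <;> omega

theorem grade_exact_eq_zero_iff (s : State N) (b₁ b₂ : Block N) :
    grade L .exact s b₁ b₂ = some 0 ↔
      aheadCount L s b₁ b₂ + (Fintype.card N - (globalANS L s).card) ≤ threshold N := by
  simp only [grade, precede_eq_one_iff]
  split_ifs <;> simp <;> omega

theorem grade_eq_zero_of_lt (g : GradeBound) {s : State N} {b₁ b₂ : Block N}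
    (h : aheadCount L s b₁ b₂ + (Fintype.card N - (globalANS L s).card) < threshold N) :
    grade L g s b₁ b₂ = some 0 := by
  cases g
  · exact (grade_strict_eq_zero_iff L s b₁ b₂).mpr h
  · exact (grade_exact_eq_zero_iff L s b₁ b₂).mpr h.le

theorem grade_eq_zero_mono (g : GradeBound) {s : State N} {b b₁ b₂ : Block N}
    (h : aheadCount L s b b₁ ≤ aheadCount L s b b₂) (h₂ : grade L g s b b₂ = some 0) :
    grade L g s b b₁ = some 0 := by
  cases g
  · rw [grade_strict_eq_zero_iff] at *
    omega
  · rw [grade_exact_eq_zero_iff] at *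
    omega

/-- With all chains in view, a candidate with the most supporters belongs to the preceding set:
a candidate ahead of it in `Φ > n / 2` chains would have more supporters. -/
theorem preceding_nonempty_of_card_eq (hΦ : Fintype.card N < 2 * threshold N) (g : GradeBound)
    {s : State N} (hC : (candidates L s).Nonempty)
    (hs : (globalANS L s).card = Fintype.card N) : (preceding L g s).Nonempty := by
  obtain ⟨b, hb, hmax⟩ := Finset.exists_max_image _ (fun b => (supporters L s b).card) hC
  refine ⟨b, Finset.mem_filter.mpr ⟨hb, fun b' hb' => grade_eq_zero_of_lt L g ?_⟩⟩
  have hle := hmax b' hb'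
  have h₁ := Finset.card_sdiff_add_card_inter (supporters L s b') (supporters L s b)
  have h₂ := Finset.card_sdiff_add_card_inter (supporters L s b) (supporters L s b')
  have h₃ : (supporters L s b' \ supporters L s b).card
      + (supporters L s b \ supporters L s b').card ≤ Fintype.card N := by
    rw [← Finset.card_union_of_disjoint disjoint_sdiff_sdiff]
    exact Finset.card_le_univ _
  rw [Finset.inter_comm] at h₂
  rw [aheadCount_eq, hs]
  omega

/-- With all chains in view and the exact bound, every candidate outside the preceding set is
preceded by some `b'`. Then `b'` has more than `Φ` supporters, so that fewer than `n - Φ < Φ`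
chains are left to be ahead of it, and `b'` is itself in the preceding set. -/
theorem internalStability_of_card_eq (hΦ : Fintype.card N < 2 * threshold N)
    {s : State N} (hs : (globalANS L s).card = Fintype.card N) :
    InternalStability L .exact s := by
  intro b hb
  obtain ⟨hbC, hbA⟩ := Finset.mem_sdiff.mp hb
  have hb' : ∃ b' ∈ candidates L s, threshold N < aheadCount L s b' b := by
    by_contra! h
    refine hbA (Finset.mem_filter.mpr ⟨hbC, fun b' hb' => ?_⟩)
    rw [grade_exact_eq_zero_iff, hs]
    have := h b' hb'
    omega
  obtain ⟨b', hb'C, hlt⟩ := hb'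
  refine ⟨b', Finset.mem_filter.mpr ⟨hb'C, fun b'' _ => ?_⟩,
    (grade_eq_one_iff L _ s b' b).mpr hlt⟩
  rw [grade_exact_eq_zero_iff, hs, aheadCount_eq]
  rw [aheadCount_eq] at hlt
  have h₁ : (supporters L s b' \ supporters L s b).card ≤ (supporters L s b').card :=
    Finset.card_le_card Finset.sdiff_subset
  have h₂ : (supporters L s b'' \ supporters L s b').card
      + (supporters L s b').card ≤ Fintype.card N := by
    rw [← Finset.card_union_of_disjoint Finset.sdiff_disjoint]
    exact Finset.card_le_univ _
  omega

theorem candidates_nonempty_of_card_eq [Nonempty N] {s : State N}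
    (hs : (globalANS L s).card = Fintype.card N) : (candidates L s).Nonempty := by
  have h : (globalANS L s).Nonempty := by
    rw [← Finset.card_pos, hs]
    exact Fintype.card_pos
  obtain ⟨q, hq⟩ := h
  obtain ⟨b, hb, -⟩ := Finset.mem_biUnion.mp hq
  exact ⟨b, hb⟩

theorem criterion_of_card_eq (hΦ : Fintype.card N < 2 * threshold N) {c : CriterionForm}
    {g : GradeBound} (hcg : c = .simplified ∨ g = .exact) {s : State N}
    (hs : (globalANS L s).card = Fintype.card N) : Criterion L c g s := by
  cases c with
  | simplified => exact .inl hs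
  | stability =>
    obtain rfl : g = .exact := by simpa using hcg
    exact ⟨internalStability_of_card_eq L hΦ hs, .inl hs⟩

theorem Criterion.preceding_nonempty [Nonempty N] (hΦ : Fintype.card N < 2 * threshold N)
    {c : CriterionForm} {g : GradeBound} {s : State N} (h : Criterion L c g s) :
    (preceding L g s).Nonempty := by
  have key := fun hs : (globalANS L s).card = Fintype.card N => preceding_nonempty_of_card_eq L hΦ g
    (candidates_nonempty_of_card_eq L hs) hs
  cases c with
  | simplified =>
    rcases h with hs | ⟨hI, b, hb⟩
    · exact key hs
    · obtain ⟨b', hb', -⟩ := hI b hb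
      exact ⟨b', hb'⟩
  | stability =>
    rcases h.2 with hs | ⟨⟨b, hb, -⟩, -⟩
    · exact key hs
    · exact ⟨b, hb⟩

theorem mem_candidates {s : State N} {b : Block N} :
    b ∈ candidates L s ↔ b ∈ pending s ∧ ∀ a ∈ L.acks b, a ∈ s.output := by
  simp [candidates]

theorem candidate_of_mem_preceding {g : GradeBound} {s : State N} {b : Block N}
    (hb : b ∈ preceding L g s) : b ∈ candidates L s :=
  (Finset.mem_filter.mp hb).1

/-! ### Progress of the run -/

section Run

variable {H : Type*} [LinearOrder H] (hash : Block N → H) (c : CriterionForm) (g : GradeBound)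
  (input : ℕ → Block N)

theorem mem_deliver_output {s : State N} {b : Block N} :
    b ∈ (deliver L hash g s).output ↔ b ∈ s.output ∨ b ∈ preceding L g s := by
  simp [deliver]

theorem run_succ (t : ℕ) : run L hash c g input (t + 1) =
    step L hash c g input (run L hash c g input t) :=
  Function.iterate_succ_apply' _ _ _

theorem run_succ_of_criterion {t : ℕ} (h : Criterion L c g (run L hash c g input t)) :
    run L hash c g input (t + 1) = deliver L hash g (run L hash c g input t) := by
  rw [run_succ, step, if_pos h]

theorem run_succ_of_not_criterion {t : ℕ} (h : ¬ Criterion L c g (run L hash c g input t)) :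
    run L hash c g input (t + 1) =
      receive (run L hash c g input t) (input (run L hash c g input t).clock) := by
  rw [run_succ, step, if_neg h]

theorem run_output_mono {t t' : ℕ} (h : t ≤ t') {b : Block N}
    (hb : b ∈ (run L hash c g input t).output) : b ∈ (run L hash c g input t').output := by
  induction t', h using Nat.le_induction with
  | base => exact hb
  | succ t' _ ih =>
    by_cases hc : Criterion L c g (run L hash c g input t')
    · rw [run_succ_of_criterion L hash c g input hc, mem_deliver_output]
      exact .inl ih
    · rw [run_succ_of_not_criterion L hash c g input hc]
      exact ih

theorem run_received_mono {t t' : ℕ} (h : t ≤ t') :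
    (run L hash c g input t).received ⊆ (run L hash c g input t').received := by
  induction t', h using Nat.le_induction with
  | base => exact subset_rfl
  | succ t' _ ih =>
    by_cases hc : Criterion L c g (run L hash c g input t')
    · rw [run_succ_of_criterion L hash c g input hc]
      exact ih
    · rw [run_succ_of_not_criterion L hash c g input hc]
      exact ih.trans (Finset.subset_insert _ _)

theorem run_output_subset_received (t : ℕ) {b : Block N}
    (hb : b ∈ (run L hash c g input t).output) : b ∈ (run L hash c g input t).received := by
  induction t with
  | zero => simp [run] at hb
  | succ t ih =>
    by_cases hc : Criterion L c g (run L hash c g input t)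
    · rw [run_succ_of_criterion L hash c g input hc] at hb ⊢
      rcases (mem_deliver_output L hash g).mp hb with hb | hb
      · exact ih hb
      · exact (mem_pending.mp
          ((mem_candidates L).mp (candidate_of_mem_preceding L hb)).1).1
    · rw [run_succ_of_not_criterion L hash c g input hc] at hb ⊢
      exact Finset.mem_insert_of_mem (ih hb)

theorem run_output_closed (t : ℕ) {b a : Block N} (hb : b ∈ (run L hash c g input t).output)
    (ha : a ∈ L.acks b) : a ∈ (run L hash c g input t).output := by
  induction t with
  | zero => simp [run] at hb
  | succ t ih =>
    by_cases hc : Criterion L c g (run L hash c g input t)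
    · rw [run_succ_of_criterion L hash c g input hc, mem_deliver_output] at hb ⊢
      rcases hb with hb | hb
      · exact .inl (ih hb)
      · exact .inl (((mem_candidates L).mp (candidate_of_mem_preceding L hb)).2 a ha)
    · rw [run_succ_of_not_criterion L hash c g input hc] at hb ⊢
      exact ih hb

/-- Every delivery outputs a new block, and only finitely many blocks are pending; so the node
never stops receiving. -/
theorem frequently_not_criterion [Nonempty N] (hΦ : Fintype.card N < 2 * threshold N) :
    ∃ᶠ t in atTop, ¬ Criterion L c g (run L hash c g input t) := by
  intro h
  obtain ⟨T, hT⟩ := eventually_atTop.mp h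
  simp only [not_not] at hT
  have hrec : ∀ d, (run L hash c g input (T + d)).received = (run L hash c g input T).received := by
    intro d
    induction d with
    | zero => rfl
    | succ d ih =>
      rw [← Nat.add_assoc, run_succ_of_criterion L hash c g input (hT _ (by omega)), ← ih]
      rfl
  have hcard : ∀ d, d ≤ (run L hash c g input (T + d)).output.toFinset.card := by
    intro d
    induction d with
    | zero => exact Nat.zero_le _
    | succ d ih =>
      have hc := hT (T + d) (by omega)
      refine ih.trans_lt (Finset.card_lt_card ?_)
      obtain ⟨x, hx⟩ := hc.preceding_nonempty L hΦ
      rw [← Nat.add_assoc, run_succ_of_criterion L hash c g input hc, Finset.ssubset_iff_of_subset]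
      · refine ⟨x, ?_, ?_⟩
        · rw [List.mem_toFinset, mem_deliver_output]
          exact .inr hx
        · rw [List.mem_toFinset]
          exact (mem_pending.mp ((mem_candidates L).mp (candidate_of_mem_preceding L hx)).1).2
      · intro y hy
        rw [List.mem_toFinset, mem_deliver_output]
        exact .inl (List.mem_toFinset.mp hy)
  have hle : ∀ d, d ≤ (run L hash c g input T).received.card := by
    intro d
    refine (hcard d).trans (Finset.card_le_card fun y hy => ?_)
    rw [← hrec d]
    exact run_output_subset_received L hash c g input _ (List.mem_toFinset.mp hy)
  exact absurd (hle _) (Nat.not_succ_le_self _)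

theorem eventually_mem_received [Nonempty N] (hΦ : Fintype.card N < 2 * threshold N)
    (h_input : ∀ b : Block N, ∃ t : ℕ, input t = b) (b : Block N) :
    ∀ᶠ t in atTop, b ∈ (run L hash c g input t).received := by
  have hfreq := frequently_atTop.mp (frequently_not_criterion L hash c g input hΦ)
  -- The first `n` inputs have been received once the clock has passed `n`.
  have key : ∀ n, ∃ t, n ≤ (run L hash c g input t).clock ∧
      ∀ i < (run L hash c g input t).clock, input i ∈ (run L hash c g input t).received := by
    have inv : ∀ t, ∀ i < (run L hash c g input t).clock,
        input i ∈ (run L hash c g input t).received := by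
      intro t
      induction t with
      | zero => simp [run]
      | succ t ih =>
        by_cases hc : Criterion L c g (run L hash c g input t)
        · rw [run_succ_of_criterion L hash c g input hc]
          exact ih
        · rw [run_succ_of_not_criterion L hash c g input hc]
          intro i hi
          rcases Nat.lt_succ_iff_lt_or_eq.mp hi with hi | rfl
          · exact Finset.mem_insert_of_mem (ih i hi)
          · exact Finset.mem_insert_self _ _
    have mono : Monotone fun t => (run L hash c g input t).clock := by
      refine monotone_nat_of_le_succ fun t => ?_
      by_cases hc : Criterion L c g (run L hash c g input t)
      · rw [run_succ_of_criterion L hash c g input hc]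
        exact le_rfl
      · rw [run_succ_of_not_criterion L hash c g input hc]
        exact Nat.le_succ _
    intro n
    suffices h : ∃ t, n ≤ (run L hash c g input t).clock from h.imp fun t ht => ⟨ht, inv t⟩
    induction n with
    | zero => exact ⟨0, Nat.zero_le _⟩
    | succ n ih =>
      obtain ⟨t, ht⟩ := ih
      obtain ⟨t', htt', hc⟩ := hfreq t
      refine ⟨t' + 1, ?_⟩
      rw [run_succ_of_not_criterion L hash c g input hc]
      exact Nat.succ_le_succ (ht.trans (mono htt'))
  obtain ⟨n, rfl⟩ := h_input b
  obtain ⟨t, hn, ht⟩ := key (n + 1)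
  exact eventually_atTop.mpr ⟨t, fun t' h => run_received_mono L hash c g input h (ht n hn)⟩

/-! ### Stuck blocks -/

/-- The set of the blocks that are output at some time. -/
def everOutput : Set (Block N) := {b | ∃ t, b ∈ (run L hash c g input t).output}

theorem everOutput_closed : ∀ x ∈ everOutput L hash c g input, ∀ a ∈ L.acks x,
    a ∈ everOutput L hash c g input :=
  fun _ ⟨t, ht⟩ _ ha => ⟨t, run_output_closed L hash c g input t ht ha⟩

/-- The first block of the chain `j` that is never output; if there is none, then `(j, 0)`, whose
presence in `stuckPast` does no harm. -/
noncomputable def firstStuck (j : N) : Block N :=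
  (j, sInf {k | (j, k) ∉ everOutput L hash c g input})

/-- The chains all of whose blocks are output. -/
noncomputable def drainedChains : Finset N :=
  Finset.univ.filter (fun j => ∀ k, (j, k) ∈ everOutput L hash c g input)

theorem mem_drainedChains {j : N} : j ∈ drainedChains L hash c g input ↔
    ∀ k, (j, k) ∈ everOutput L hash c g input := by
  simp [drainedChains]

/-- The blocks supported by the first stuck blocks of the chains. Once the node has settled all of
them, the first pending blocks of the chains that are not drained no longer change. -/
def stuckPast : Set (Block N) := {x | ∃ j, L.AcksStar (firstStuck L hash c g input j) x}

/-- At time `t` the node has received all of `stuckPast` and has output those of its blocks that it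
will ever output. -/
def IsSettled (t : ℕ) : Prop :=
  ∀ x ∈ stuckPast L hash c g input, x ∈ (run L hash c g input t).received ∧
    (x ∈ (run L hash c g input t).output ↔ x ∈ everOutput L hash c g input)

theorem finite_stuckPast : (stuckPast L hash c g input).Finite := by
  have h : stuckPast L hash c g input =
      ⋃ j, {x | L.AcksStar (firstStuck L hash c g input j) x} := by
    ext x
    simp [stuckPast]
  rw [h]
  exact Set.finite_iUnion fun j => L.finite_setOf_acksStar _

theorem eventually_isSettled [Nonempty N] (hΦ : Fintype.card N < 2 * threshold N)
    (h_input : ∀ b : Block N, ∃ t : ℕ, input t = b) :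
    ∀ᶠ t in atTop, IsSettled L hash c g input t := by
  refine (eventually_all_finite (finite_stuckPast L hash c g input)).mpr fun x _ => ?_
  refine (eventually_mem_received L hash c g input hΦ h_input x).and ?_
  by_cases hx : x ∈ everOutput L hash c g input
  · obtain ⟨t, ht⟩ := hx
    exact eventually_atTop.mpr ⟨t, fun t' h =>
      iff_of_true (run_output_mono L hash c g input h ht) ⟨t, ht⟩⟩
  · exact .of_forall fun t => iff_of_false (fun h => hx ⟨t, h⟩) hx

/-- The acking rule makes late blocks of a chain outside `F` support any given stuck block; so only
chains in `F` can be drained. -/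
theorem drainedChains_subset {b : Block N} (hb : b ∉ everOutput L hash c g input) {F : Finset N}
    {view : Block N → Finset (Block N)} (h_rule : ∀ q ∉ F, FollowsAckRule L view q)
    (h_network : ∀ q ∉ F, ∀ b : Block N, ∀ᶠ i in atTop, b ∈ view (q, i)) :
    drainedChains L hash c g input ⊆ F := by
  intro q hq
  by_contra hqF
  obtain ⟨i, hi⟩ := (h_rule q hqF).exists_acksStar (h_network q hqF b)
  exact hb (hi.mem (everOutput_closed L hash c g input) ((mem_drainedChains L hash c g input).mp hq i))

variable {L hash c g input}

theorem firstStuck_notMem {j : N} (hj : j ∉ drainedChains L hash c g input) :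
    firstStuck L hash c g input j ∉ everOutput L hash c g input := by
  have h : {k | (j, k) ∉ everOutput L hash c g input}.Nonempty := by
    simpa [mem_drainedChains, Set.Nonempty] using hj
  exact Nat.sInf_mem h

theorem firstHeight_of_settled {t : ℕ} (hs : IsSettled L hash c g input t) {j : N}
    (hj : j ∉ drainedChains L hash c g input) :
    (j, firstHeight (run L hash c g input t) j) = firstStuck L hash c g input j := by
  have hstuck := firstStuck_notMem hj
  have hpend : firstStuck L hash c g input j ∈ pending (run L hash c g input t) :=
    mem_pending.mpr ⟨(hs _ ⟨j, .refl⟩).1, fun h => hstuck ⟨t, h⟩⟩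
  refine Prod.ext rfl (le_antisymm (Nat.sInf_le hpend) (le_csInf ⟨_, hpend⟩ fun i hi => ?_))
  by_contra! hlt
  have hU : (j, i) ∈ everOutput L hash c g input := by
    by_contra h
    exact absurd (Nat.sInf_le (s := {k | (j, k) ∉ everOutput L hash c g input}) h) (not_le.mpr hlt)
  exact (mem_pending.mp hi).2 ((hs _ ⟨j, L.acksStar_of_le j hlt.le⟩).2.mpr hU)

/-- In the past of a chain that is not drained there is a stuck block that is a candidate. -/
theorem exists_stuck_candidate {t : ℕ} (hs : IsSettled L hash c g input t) {j : N}
    (hj : j ∉ drainedChains L hash c g input) :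
    ∃ m ∈ candidates L (run L hash c g input t), m ∉ everOutput L hash c g input ∧
      L.AcksStar (firstStuck L hash c g input j) m := by
  obtain ⟨m, hjm, hm, hmin⟩ := L.exists_minimal _ _ (firstStuck_notMem hj)
  refine ⟨m, (mem_candidates L).mpr ⟨mem_pending.mpr ⟨(hs m ⟨j, hjm⟩).1, fun h => hm ⟨t, h⟩⟩,
    fun a ha => (hs a ⟨j, hjm.tail ha⟩).2.mpr (hmin a ha)⟩, hm, hjm⟩

theorem mem_globalANS_of_settled {t : ℕ} (hs : IsSettled L hash c g input t) {j : N}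
    (hj : j ∉ drainedChains L hash c g input) :
    j ∈ globalANS L (run L hash c g input t) := by
  obtain ⟨m, hmC, -, hjm⟩ := exists_stuck_candidate hs hj
  refine Finset.mem_biUnion.mpr ⟨m, hmC, ?_⟩
  simp only [ANS, Finset.mem_filter, Finset.mem_univ, true_and]
  exact ⟨_, mem_pending.mpr
    ⟨(hs _ ⟨j, .refl⟩).1, fun h => firstStuck_notMem hj ⟨t, h⟩⟩, hjm⟩

/-- A pending block that will be output is supported by drained chains only. -/
theorem supporters_subset_of_mem {t : ℕ} (hs : IsSettled L hash c g input t) {x : Block N}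
    (hx : x ∈ pending (run L hash c g input t))
    (hxU : x ∈ everOutput L hash c g input) :
    supporters L (run L hash c g input t) x ⊆ drainedChains L hash c g input := by
  intro j hj
  by_contra hjD
  have hjx := ((mem_supporters L).mp hj).2
  rw [firstHeight_of_settled hs hjD] at hjx
  exact (mem_pending.mp hx).2 ((hs x ⟨j, hjx⟩).2.mpr hxU)

/-- A block that is never output is not supported by a drained chain. -/
theorem disjoint_supporters_of_notMem {t : ℕ} {x : Block N}
    (hxU : x ∉ everOutput L hash c g input) :
    Disjoint (supporters L (run L hash c g input t) x) (drainedChains L hash c g input) := by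
  refine Finset.disjoint_left.mpr fun j hj hjD => hxU ?_
  exact ((mem_supporters L).mp hj).2.mem (everOutput_closed L hash c g input)
    ((mem_drainedChains L hash c g input).mp hjD _)

/-- If the criterion failed from some time on, only finitely many blocks would ever be output, so no
chain would be drained; then all chains would come into view, and the criterion would hold. -/
theorem frequently_criterion [Nonempty N] (hΦ : Fintype.card N < 2 * threshold N)
    (h_input : ∀ b : Block N, ∃ t : ℕ, input t = b) (hcg : c = .simplified ∨ g = .exact) :
    ∃ᶠ t in atTop, Criterion L c g (run L hash c g input t) := by
  intro h
  obtain ⟨T, hT⟩ := eventually_atTop.mp h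
  have hout : ∀ t, T ≤ t → (run L hash c g input t).output = (run L hash c g input T).output := by
    intro t ht
    induction t, ht using Nat.le_induction with
    | base => rfl
    | succ t ht ih =>
      rw [run_succ_of_not_criterion L hash c g input (hT t ht), ← ih]
      rfl
  have hdrained : ∀ j, j ∉ drainedChains L hash c g input := by
    intro j hj
    have hfin : {k | (j, k) ∈ (run L hash c g input T).output.toFinset}.Finite :=
      (Finset.finite_toSet _).preimage (Prod.mk_right_injective j).injOn
    refine Set.infinite_univ (hfin.subset fun k _ => ?_)
    obtain ⟨t, ht⟩ := (mem_drainedChains L hash c g input).mp hj k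
    have := run_output_mono L hash c g input (le_max_left t T) ht
    rw [hout _ (le_max_right t T)] at this
    exact List.mem_toFinset.mpr this
  obtain ⟨t, hs, ht⟩ :=
    ((eventually_isSettled L hash c g input hΦ h_input).and (eventually_ge_atTop T)).exists
  refine hT t ht (criterion_of_card_eq L hΦ hcg (Finset.card_eq_iff_eq_univ _ |>.mpr ?_))
  exact Finset.eq_univ_of_forall fun j => mem_globalANS_of_settled hs (hdrained j)

/-- If the preceding set of a settled state contains some `x`, then it contains every candidate `m`.
A candidate that will be output has at most `f_max` supporters, all drained, and at most `f_max`
chains are out of view, which is too few to be ahead of `m`. A stuck candidate shares no supporter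
with `x`, so it is ahead of `x` wherever it is ahead of `m`. -/
theorem mem_preceding_of_isSettled {t : ℕ} (hs : IsSettled L hash c g input t)
    (hD : (drainedChains L hash c g input).card ≤ fMax N) {x m : Block N}
    (hx : x ∈ preceding L g (run L hash c g input t)) (hxU : x ∈ everOutput L hash c g input)
    (hm : m ∈ candidates L (run L hash c g input t)) :
    m ∈ preceding L g (run L hash c g input t) := by
  refine Finset.mem_filter.mpr ⟨hm, fun b hb => ?_⟩
  obtain ⟨hxC, hx⟩ := Finset.mem_filter.mp hx
  by_cases hbU : b ∈ everOutput L hash c g input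
  · apply grade_eq_zero_of_lt
    have h₁ : aheadCount L (run L hash c g input t) b m
        ≤ (drainedChains L hash c g input).card := by
      rw [aheadCount_eq]
      exact Finset.card_le_card (Finset.sdiff_subset.trans
        (supporters_subset_of_mem hs ((mem_candidates L).mp hb).1 hbU))
    have h₂ : Fintype.card N - (globalANS L (run L hash c g input t)).card
        ≤ (drainedChains L hash c g input).card := by
      rw [← Finset.card_compl]
      refine Finset.card_le_card fun j hj => ?_
      by_contra hjD
      exact Finset.mem_compl.mp hj (mem_globalANS_of_settled hs hjD)
    unfold threshold
    omega
  · refine grade_eq_zero_mono L g ?_ (hx b hb)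
    rw [aheadCount_eq, aheadCount_eq]
    refine Finset.card_le_card fun j hj => ?_
    have hjb := (Finset.mem_sdiff.mp hj).1
    refine Finset.mem_sdiff.mpr ⟨hjb, fun hjx => ?_⟩
    exact Finset.disjoint_left.mp (disjoint_supporters_of_notMem hbU) hjb
      (supporters_subset_of_mem hs ((mem_candidates L).mp hxC).1 hxU hjx)

end Run

end Dexon

theorem mainTheorem5 {N : Type*} [Fintype N] {H : Type*} [LinearOrder H]
    (hΦ : Fintype.card N < 2 * Dexon.threshold N)
    (L : Dexon.Blocklattice N) (hash : Dexon.Block N → H)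
    (F : Finset N) (hF : F.card ≤ Dexon.fMax N)
    (view : Dexon.Block N → Finset (Dexon.Block N))
    (h_rule : ∀ q ∉ F, Dexon.FollowsAckRule L view q)
    (h_network : ∀ q ∉ F, ∀ b : Dexon.Block N, ∀ᶠ i in Filter.atTop, b ∈ view (q, i))
    (input : ℕ → Dexon.Block N) (h_input : ∀ b : Dexon.Block N, ∃ t : ℕ, input t = b)
    (c : Dexon.CriterionForm) (g : Dexon.GradeBound)
    (hcg : c = Dexon.CriterionForm.simplified ∨ g = Dexon.GradeBound.exact)
    (b : Dexon.Block N) :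
    ∃ t : ℕ, b ∈ (Dexon.run L hash c g input t).output := by
  have : Nonempty N := ⟨b.1⟩
  by_contra hb
  have hbU : b ∉ Dexon.everOutput L hash c g input := hb
  have hD := Dexon.drainedChains_subset L hash c g input hbU h_rule h_network
  have hj : b.1 ∉ Dexon.drainedChains L hash c g input :=
    fun h => hbU ((Dexon.mem_drainedChains L hash c g input).mp h b.2)
  obtain ⟨t, hc, hs⟩ := ((Dexon.frequently_criterion (hash := hash) hΦ h_input hcg).and_eventually
    (Dexon.eventually_isSettled L hash c g input hΦ h_input)).exists
  have hout : ∀ y ∈ Dexon.preceding L g (Dexon.run L hash c g input t),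
      y ∈ Dexon.everOutput L hash c g input := by
    intro y hy
    refine ⟨t + 1, ?_⟩
    rw [Dexon.run_succ_of_criterion L hash c g input hc, Dexon.mem_deliver_output]
    exact .inr hy
  obtain ⟨x, hx⟩ := hc.preceding_nonempty L hΦ
  obtain ⟨m, hmC, hmU, -⟩ := Dexon.exists_stuck_candidate hs hj
  exact hmU (hout m (Dexon.mem_preceding_of_isSettled hs ((Finset.card_le_card hD).trans hF) hx
    (hout x hx) hmC))
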